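/- \textbf{Theorem (discretized spectral averaging).} Let $\mathcal H$ be a separable complex Hilbert space, let $A$ be a (possibly unbounded) self-adjoint operator on $\mathcal H$ with domain $D(A)$, and let $B$ be a bounded nonnegative self-adjoint operator on $\mathcal H$. For $t\in\mathbb R$ let $A+tB$ be the operator with domain $D(A)$, and let $(A+tB)^2+1$ have its natural domain $\{x\in D(A) : (A+tB)x\in D(A)\}$. Then for every $t\in\mathbb R$ the operator $(A+tB)^2+1$ has an everywhere defined bounded inverse, and for every $\varphi\in\mathcal H$ the numbers $\langle B\varphi, ((A+tB)^2+1)^{-1}B\varphi\rangle$ are real and nonnegative, the suprema below are finite, the series converges, and $$\sum_{n\in\mathbb Z}\ \sup_{y\in[0,1]}\ \Big\langle B\varphi,\ \frac{1}{(A+(n+y)B)^2+1}\,B\varphi\Big\rangle\ \le\ \pi\,\|B\|\,(1+\|B\|)\,\|\varphi\|^2 .$$ -/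

import Mathlib

/-- The product `S T` of two unbounded operators, on its natural domain
`{x ∈ D(T) : T x ∈ D(S)}`. -/
def unboundedComp {H : Type*} [AddCommGroup H] [Module ℂ H] (S T : H →ₗ.[ℂ] H) :
    H →ₗ.[ℂ] H where
  domain :=
    { carrier := {x | ∃ h : x ∈ T.domain, T ⟨x, h⟩ ∈ S.domain}
      zero_mem' := ⟨T.domain.zero_mem, by
        have h0 : T ⟨0, T.domain.zero_mem⟩ = 0 := T.map_zero
        rw [h0]
        exact S.domain.zero_mem⟩
      add_mem' := by
        rintro a b ⟨ha, hSa⟩ ⟨hb, hSb⟩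
        refine ⟨T.domain.add_mem ha hb, ?_⟩
        have h : T ⟨a + b, T.domain.add_mem ha hb⟩ = T ⟨a, ha⟩ + T ⟨b, hb⟩ :=
          T.map_add ⟨a, ha⟩ ⟨b, hb⟩
        rw [h]
        exact S.domain.add_mem hSa hSb
      smul_mem' := by
        rintro c a ⟨ha, hSa⟩
        refine ⟨T.domain.smul_mem c ha, ?_⟩
        have h : T ⟨c • a, T.domain.smul_mem c ha⟩ = c • T ⟨a, ha⟩ := T.map_smul c ⟨a, ha⟩
        rw [h]
        exact S.domain.smul_mem c hSa }
  toFun :=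
    { toFun := fun x => S ⟨T ⟨x, x.2.fst⟩, x.2.snd⟩
      map_add' := by
        intro x y
        rw [← S.map_add]
        congr 1
        exact Subtype.ext (T.map_add ⟨x, x.2.fst⟩ ⟨y, y.2.fst⟩)
      map_smul' := by
        intro c x
        rw [RingHom.id_apply, ← S.map_smul]
        congr 1
        exact Subtype.ext (T.map_smul c ⟨x, x.2.fst⟩) }

section

variable {H : Type*} [NormedAddCommGroup H] [InnerProductSpace ℂ H]

/-- The operator `A + t B` with domain `D(A)`, for `A` unbounded, `B` bounded and `t` real. -/
def perturbedOperator (A : H →ₗ.[ℂ] H) (B : H →L[ℂ] H) (t : ℝ) : H →ₗ.[ℂ] H :=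
  (((t : ℂ) • B : H →L[ℂ] H) : H →ₗ[ℂ] H) +ᵥ A

/-- The operator `T² + 1` with domain `{x ∈ D(T) : T x ∈ D(T)}`. -/
def sqAddOne (T : H →ₗ.[ℂ] H) : H →ₗ.[ℂ] H :=
  (LinearMap.id : H →ₗ[ℂ] H) +ᵥ unboundedComp T T

/-- `R` is the everywhere defined bounded inverse of the unbounded operator `S`: it maps `H`
into `D(S)`, `S R ψ = ψ` for all `ψ`, and `R S x = x` for all `x ∈ D(S)`. -/
def IsBoundedInverse (S : H →ₗ.[ℂ] H) (R : H →L[ℂ] H) : Prop :=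
  (∀ ψ : H, ∃ h : R ψ ∈ S.domain, S ⟨R ψ, h⟩ = ψ) ∧ ∀ x : S.domain, R (S x) = x

theorem IsBoundedInverse.unique {S : H →ₗ.[ℂ] H} {R R' : H →L[ℂ] H}
    (h : IsBoundedInverse S R) (h' : IsBoundedInverse S R') : R = R' := by
  ext ψ
  obtain ⟨hm, hS⟩ := h'.1 ψ
  have := h.2 ⟨R' ψ, hm⟩
  rwa [hS] at this

open Classical in
/-- The bounded inverse `S⁻¹` of an unbounded operator (zero if there is none). -/
noncomputable def boundedInverse (S : H →ₗ.[ℂ] H) : H →L[ℂ] H :=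
  if h : ∃ R, IsBoundedInverse S R then h.choose else 0

theorem IsBoundedInverse.boundedInverse_eq {S : H →ₗ.[ℂ] H} {R : H →L[ℂ] H}
    (h : IsBoundedInverse S R) : boundedInverse S = R := by
  have hex : ∃ R, IsBoundedInverse S R := ⟨R, h⟩
  unfold boundedInverse
  rw [dif_pos hex]
  exact hex.choose_spec.unique h

/-- The bounded operator `((A + t B)² + 1)⁻¹`. -/
noncomputable def averagingResolvent (A : H →ₗ.[ℂ] H) (B : H →L[ℂ] H) (t : ℝ) : H →L[ℂ] H :=
  boundedInverse (sqAddOne (perturbedOperator A B t))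

/-- The matrix element `⟨B φ, ((A + t B)² + 1)⁻¹ B φ⟩`. -/
noncomputable def averagingElement (A : H →ₗ.[ℂ] H) (B : H →L[ℂ] H) (φ : H) (t : ℝ) : ℂ :=
  inner ℂ (B φ) (averagingResolvent A B t (B φ))

end

/-! Put `v = B φ` and `F(w) = -⟨v, (A + wB + i)⁻¹ v⟩`. Since `B ≥ 0`, the imaginary part of `wB + i`
is at least 1 for `Im w ≥ 0`, so the inverse exists and is a contraction, and `F` is bounded,
holomorphic in the open upper half-plane and differentiable up to the real line, with `Im F ≥ 0`.
For real `t`, `f(t) = Im F(t) = ‖(A + tB + i)⁻¹ v‖²` is exactly the matrix element to be summed.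

Two estimates suffice. Spectral averaging (`integral_im_couplingElement_le`): positivity of `B`
gives `η Im F(iη) ≤ ⟨φ, Bφ⟩`, and the Poisson formula as `η → ∞` turns this into `∫ f ≤ π ⟨φ, Bφ⟩`.
Slow variation (`abs_deriv_im_couplingElement_le`): `|f'| ≤ ‖B‖ f`, so the supremum of `f` over a
unit interval is at most `1 + ‖B‖` times its integral there (`le_one_add_mul_integral`). Summing
over unit intervals gives the bound. The resolvents are built directly from self-adjointness,
without the spectral theorem. -/

/-! ### The Cayley transform and its boundary values -/

/-- The Cayley transform of the unit disc onto the upper half-plane, with centre `η i`. -/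
noncomputable def cayleyUpper (η : ℝ) (ζ : ℂ) : ℂ := η * Complex.I * ((1 + ζ) / (1 - ζ))

theorem cayleyUpper_zero (η : ℝ) : cayleyUpper η 0 = η * Complex.I := by
  simp [cayleyUpper]

theorem cayleyUpper_im (η : ℝ) (ζ : ℂ) :
    (cayleyUpper η ζ).im = η * ((1 - Complex.normSq ζ) / Complex.normSq (1 - ζ)) := by
  have h : ((1 + ζ) / (1 - ζ)).re = (1 - Complex.normSq ζ) / Complex.normSq (1 - ζ) := by
    rw [Complex.div_re, ← add_div]
    congr 1
    simp [Complex.normSq_apply]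
    ring
  rw [cayleyUpper, mul_assoc, Complex.im_ofReal_mul, Complex.I_mul_im, h]

theorem cayleyUpper_im_pos {η : ℝ} (hη : 0 < η) {ζ : ℂ} (hζ : ‖ζ‖ < 1) :
    0 < (cayleyUpper η ζ).im := by
  rw [cayleyUpper_im]
  have h1 : 0 < 1 - Complex.normSq ζ := by
    rw [Complex.normSq_eq_norm_sq]
    nlinarith [norm_nonneg ζ]
  have h2 : 0 < Complex.normSq (1 - ζ) := by
    rw [Complex.normSq_pos, sub_ne_zero]
    rintro rfl
    simp at hζ
  positivity

theorem exp_two_arctan_mul_I (s : ℝ) :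
    Complex.exp ((2 * Real.arctan s : ℝ) * Complex.I) =
      (1 + s * Complex.I) / (1 - s * Complex.I) := by
  have h1 : (1 : ℂ) + s * Complex.I ≠ 0 := fun h => by simpa using congrArg Complex.re h
  have h2 : (1 : ℂ) - s * Complex.I ≠ 0 := fun h => by simpa using congrArg Complex.re h
  rw [← Complex.exp_log (div_ne_zero h1 h2)]
  congr 1
  push_cast
  rw [Complex.arctan]
  linear_combination (-Complex.log ((1 + s * Complex.I) / (1 - s * Complex.I))) * Complex.I_sq

theorem circleMap_pi_add_two_arctan (r s : ℝ) :
    circleMap 0 r (Real.pi + 2 * Real.arctan s) =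
      -(r * ((1 + s * Complex.I) / (1 - s * Complex.I))) := by
  rw [circleMap, zero_add, ← exp_two_arctan_mul_I]
  push_cast
  rw [add_mul, Complex.exp_add, Complex.exp_pi_mul_I]
  ring

theorem one_sub_circleMap_ne_zero (s : ℝ) :
    1 - circleMap 0 1 (Real.pi + 2 * Real.arctan s) ≠ 0 := by
  have h2 : (1 : ℂ) - s * Complex.I ≠ 0 := fun h => by simpa using congrArg Complex.re h
  rw [circleMap_pi_add_two_arctan]
  have : 1 - -(((1 : ℝ) : ℂ) * ((1 + s * Complex.I) / (1 - s * Complex.I))) =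
      2 / (1 - s * Complex.I) := by
    field_simp
    push_cast
    ring
  rw [this]
  exact div_ne_zero two_ne_zero h2

/-- As `s` runs over the line, the angle `π + 2 arctan s` sweeps `(0, 2π)`, missing only the pole `ζ
= 1`, which corresponds to infinity. -/
theorem cayleyUpper_circleMap (η s : ℝ) :
    cayleyUpper η (circleMap 0 1 (Real.pi + 2 * Real.arctan s)) = (η * s : ℝ) := by
  have h2 : (1 : ℂ) - s * Complex.I ≠ 0 := fun h => by simpa using congrArg Complex.re h
  have h3 := one_sub_circleMap_ne_zero s
  have hu : (1 + s * Complex.I) / (1 - s * Complex.I) * (1 - s * Complex.I) = 1 + s * Complex.I :=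
    div_mul_cancel₀ _ h2
  rw [cayleyUpper, mul_div_assoc', div_eq_iff h3, circleMap_pi_add_two_arctan]
  refine mul_right_cancel₀ h2 ?_
  push_cast
  linear_combination (-(η * Complex.I + η * s)) * hu + (-2 * η * s : ℂ) * Complex.I_sq

open Filter Topology in
theorem tendsto_cayleyUpper_circleMap (η s : ℝ) :
    Tendsto (fun r : ℝ => cayleyUpper η (circleMap 0 r (Real.pi + 2 * Real.arctan s)))
      (𝓝 1) (𝓝 ((η * s : ℝ) : ℂ)) := by
  rw [← cayleyUpper_circleMap]
  have hc : ContinuousAt (fun r : ℝ => circleMap 0 r (Real.pi + 2 * Real.arctan s)) 1 := by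
    unfold circleMap
    fun_prop
  have := one_sub_circleMap_ne_zero s
  have h : ContinuousAt (fun r : ℝ =>
      cayleyUpper η (circleMap 0 r (Real.pi + 2 * Real.arctan s))) 1 := by
    unfold cayleyUpper
    exact continuousAt_const.mul ((continuousAt_const.add hc).div (continuousAt_const.sub hc) this)
  exact h

/-! ### Poisson bounds in the upper half-plane -/

section HalfPlane

variable {G : ℂ → ℂ}

theorem norm_circleMap_zero_lt {r : ℝ} (h0 : 0 < r) (h1 : r < 1) (θ : ℝ) :
    ‖circleMap 0 r θ‖ < 1 := by
  rw [norm_circleMap_zero, abs_of_pos h0]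
  exact h1

theorem differentiableOn_comp_cayleyUpper (hd : DifferentiableOn ℂ G {w | 0 < w.im}) {η : ℝ}
    (hη : 0 < η) : DifferentiableOn ℂ (fun ζ => G (cayleyUpper η ζ)) (Metric.ball 0 1) := by
  refine hd.comp ?_ fun ζ hζ => cayleyUpper_im_pos hη (by simpa using hζ)
  intro ζ hζ
  have : 1 - ζ ≠ 0 := by
    rw [sub_ne_zero]
    rintro rfl
    simp at hζ
  unfold cayleyUpper
  exact (by fun_prop (disch := assumption) : DifferentiableAt ℂ _ ζ).differentiableWithinAt

theorem continuous_comp_cayleyUpper_circleMap (hd : DifferentiableOn ℂ G {w | 0 < w.im}) {η : ℝ}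
    (hη : 0 < η) {r : ℝ} (h0 : 0 < r) (h1 : r < 1) :
    Continuous fun θ : ℝ => G (cayleyUpper η (circleMap 0 r θ)) :=
  (differentiableOn_comp_cayleyUpper hd hη).continuousOn.comp_continuous
    (continuous_circleMap 0 r) fun θ => by simpa using norm_circleMap_zero_lt h0 h1 θ

theorem integral_im_comp_cayleyUpper (hd : DifferentiableOn ℂ G {w | 0 < w.im}) {η : ℝ}
    (hη : 0 < η) {r : ℝ} (h0 : 0 < r) (h1 : r < 1) :
    ∫ θ in (0 : ℝ)..2 * Real.pi, (G (cayleyUpper η (circleMap 0 r θ))).im =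
      2 * Real.pi * (G (η * Complex.I)).im := by
  have hdc : DiffContOnCl ℂ (fun ζ => G (cayleyUpper η ζ)) (Metric.ball 0 |r|) := by
    refine DifferentiableOn.diffContOnCl ?_
    rw [closure_ball _ (abs_pos.2 h0.ne').ne']
    refine (differentiableOn_comp_cayleyUpper hd hη).mono (Metric.closedBall_subset_ball ?_)
    rwa [abs_of_pos h0]
  have h := hdc.circleAverage
  rw [Real.circleAverage_def, cayleyUpper_zero] at h
  have hi : IntervalIntegrable (fun θ : ℝ => G (cayleyUpper η (circleMap 0 r θ)))
      MeasureTheory.volume 0 (2 * Real.pi) :=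
    (continuous_comp_cayleyUpper_circleMap hd hη h0 h1).intervalIntegrable _ _
  have h3 := Complex.imCLM.intervalIntegral_comp_comm hi
  simp only [Complex.imCLM_apply] at h3
  rw [h3, ← h, Complex.smul_im, smul_eq_mul]
  have := Real.pi_pos
  field_simp

/-- The substitution `θ = π + 2 arctan (t / η)` turns `dθ` into twice the Poisson kernel `η / (η² +
t²) dt`. The interval `[-R, R]` covers only an arc of the circle, and nonnegativity bounds its
integral by the full circular mean. Radii `r < 1` keep the argument inside the domain of holomorphy.
-/
theorem integral_poisson_cayleyUpper_le (hd : DifferentiableOn ℂ G {w | 0 < w.im})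
    (hpos : ∀ w : ℂ, 0 ≤ w.im → 0 ≤ (G w).im) {η : ℝ} (hη : 0 < η) {r : ℝ} (h0 : 0 < r)
    (h1 : r < 1) {R : ℝ} (hR : 0 < R) :
    ∫ t in -R..R, (G (cayleyUpper η (circleMap 0 r (Real.pi + 2 * Real.arctan (t / η))))).im *
      (2 * (1 / (1 + (t / η) ^ 2) * (1 / η))) ≤ 2 * Real.pi * (G (η * Complex.I)).im := by
  have hcont : Continuous fun θ : ℝ => (G (cayleyUpper η (circleMap 0 r θ))).im :=
    Complex.continuous_im.comp (continuous_comp_cayleyUpper_circleMap hd hη h0 h1)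
  have hderiv : ∀ t ∈ Set.uIcc (-R) R,
      HasDerivAt (fun t : ℝ => Real.pi + 2 * Real.arctan (t / η))
        (2 * (1 / (1 + (t / η) ^ 2) * (1 / η))) t := fun t _ =>
    ((((hasDerivAt_id t).div_const η).arctan).const_mul 2).const_add _
  have hcd : ContinuousOn (fun t : ℝ => 2 * (1 / (1 + (t / η) ^ 2) * (1 / η)))
      (Set.uIcc (-R) R) := by
    have : ∀ t : ℝ, 1 + (t / η) ^ 2 ≠ 0 := fun t => by positivity
    exact (by fun_prop (disch := simpa using this) : Continuous _).continuousOn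
  have hsub := intervalIntegral.integral_comp_mul_deriv hderiv hcd hcont
  simp only [Function.comp_def] at hsub
  rw [hsub, ← integral_im_comp_cayleyUpper hd hη h0 h1]
  have ha1 := Real.neg_pi_div_two_lt_arctan (-R / η)
  have ha2 := Real.arctan_lt_pi_div_two (R / η)
  have ha3 : Real.arctan (-R / η) ≤ Real.arctan (R / η) :=
    Real.arctan_strictMono.monotone (by gcongr; linarith)
  refine intervalIntegral.integral_mono_interval (by linarith) (by linarith) (by linarith)
    (Filter.Eventually.of_forall fun θ => hpos _ ?_) (hcont.intervalIntegrable _ _)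
  exact (cayleyUpper_im_pos hη (norm_circleMap_zero_lt h0 h1 θ)).le

open Filter Topology in
/-- The Poisson integral over a bounded interval of the boundary values of a nonnegative harmonic
function is at most the value of the function. -/
theorem integral_poisson_le (hc : ContinuousOn G {w | 0 ≤ w.im})
    (hd : DifferentiableOn ℂ G {w | 0 < w.im}) {M : ℝ} (hM : ∀ w : ℂ, 0 ≤ w.im → ‖G w‖ ≤ M)
    (hpos : ∀ w : ℂ, 0 ≤ w.im → 0 ≤ (G w).im) {η : ℝ} (hη : 0 < η) {R : ℝ} (hR : 0 < R) :
    ∫ t in -R..R, (G t).im * (2 * (1 / (1 + (t / η) ^ 2) * (1 / η))) ≤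
      2 * Real.pi * (G (η * Complex.I)).im := by
  have hev : ∀ᶠ r : ℝ in 𝓝[<] 1, 0 < r ∧ r < 1 := by
    filter_upwards [Ioo_mem_nhdsLT (zero_lt_one' ℝ)] with r hr using hr
  have hcd : Continuous fun t : ℝ => 2 * (1 / (1 + (t / η) ^ 2) * (1 / η)) := by
    have : ∀ t : ℝ, 1 + (t / η) ^ 2 ≠ 0 := fun t => by positivity
    fun_prop (disch := simpa using this)
  -- Let `r → 1` from below; the bound `M` times the kernel dominates.
  refine le_of_tendsto (f := fun r : ℝ => ∫ t in -R..R,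
    (G (cayleyUpper η (circleMap 0 r (Real.pi + 2 * Real.arctan (t / η))))).im *
      (2 * (1 / (1 + (t / η) ^ 2) * (1 / η)))) (x := 𝓝[<] 1) ?_
    (hev.mono fun r hr => integral_poisson_cayleyUpper_le hd hpos hη hr.1 hr.2 hR)
  refine intervalIntegral.tendsto_integral_filter_of_dominated_convergence
    (fun t => M * (2 * (1 / (1 + (t / η) ^ 2) * (1 / η)))) ?_ ?_ ?_ ?_
  · filter_upwards [hev] with r hr
    refine Continuous.aestronglyMeasurable (Continuous.mul ?_ hcd)
    refine Complex.continuous_im.comp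
      ((continuous_comp_cayleyUpper_circleMap hd hη hr.1 hr.2).comp ?_)
    exact continuous_const.add
      (continuous_const.mul (Real.continuous_arctan.comp (continuous_id.div_const η)))
  · filter_upwards [hev] with r hr
    refine Eventually.of_forall fun t _ => ?_
    rw [norm_mul, Real.norm_of_nonneg (r := 2 * _) (by positivity)]
    gcongr
    exact (Complex.abs_im_le_norm _).trans
      (hM _ (cayleyUpper_im_pos hη (norm_circleMap_zero_lt hr.1 hr.2 _)).le)
  · exact (continuous_const.mul hcd).intervalIntegrable _ _
  · refine Eventually.of_forall fun t _ => Tendsto.mul_const _ ?_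
    refine (Complex.continuous_im.tendsto _).comp ?_
    refine (hc t (by simp)).tendsto.comp (tendsto_nhdsWithin_iff.2 ⟨?_, ?_⟩)
    · have := tendsto_cayleyUpper_circleMap η (t / η)
      rw [mul_div_cancel₀ _ hη.ne'] at this
      exact this.mono_left nhdsWithin_le_nhds
    · filter_upwards [hev] with r hr
      exact (cayleyUpper_im_pos hη (norm_circleMap_zero_lt hr.1 hr.2 _)).le

open Filter Topology in
/-- A bounded holomorphic function on the upper half-plane with nonnegative imaginary part whose
imaginary part decays like `C / η` along the imaginary axis has boundary values of total mass at
most `π C`. -/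
theorem integral_im_le_of_upperHalfPlane (hc : ContinuousOn G {w | 0 ≤ w.im})
    (hd : DifferentiableOn ℂ G {w | 0 < w.im}) {M : ℝ} (hM : ∀ w : ℂ, 0 ≤ w.im → ‖G w‖ ≤ M)
    (hpos : ∀ w : ℂ, 0 ≤ w.im → 0 ≤ (G w).im) {C : ℝ}
    (hC : ∀ η : ℝ, 0 < η → η * (G (η * Complex.I)).im ≤ C) {R : ℝ} (hR : 0 < R) :
    ∫ t in -R..R, (G t).im ≤ Real.pi * C := by
  have hcont : Continuous fun t : ℝ => (G t).im :=
    Complex.continuous_im.comp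
      (hc.comp_continuous Complex.continuous_ofReal fun t => by simp)
  -- On `[-R, R]` the kernel times `η / 2` is at least `1 / (1 + (R / η)²)`. With `R` fixed, this
  -- loss tends to 1 as `η → ∞`.
  have key : ∀ η : ℝ, 0 < η →
      ∫ t in -R..R, (G t).im ≤ (1 + (R / η) ^ 2) * (Real.pi * C) := by
    intro η hη
    have hcd : Continuous fun t : ℝ => 2 * (1 / (1 + (t / η) ^ 2) * (1 / η)) := by
      have : ∀ t : ℝ, 1 + (t / η) ^ 2 ≠ 0 := fun t => by positivity
      fun_prop (disch := simpa using this)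
    have h1 := integral_poisson_le hc hd hM hpos hη hR
    have h2 : ∫ t in -R..R, (G t).im ≤ ∫ t in -R..R, (1 + (R / η) ^ 2) * (η / 2) *
        ((G t).im * (2 * (1 / (1 + (t / η) ^ 2) * (1 / η)))) := by
      refine intervalIntegral.integral_mono_on (by linarith) (hcont.intervalIntegrable _ _)
        ((continuous_const.mul (hcont.mul hcd)).intervalIntegrable _ _) fun t ht => ?_
      have h3 : (t / η) ^ 2 ≤ (R / η) ^ 2 := by
        rw [div_pow, div_pow]
        gcongr ?_ / _
        exact sq_le_sq' ht.1 ht.2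
      have h4 : (1 + (R / η) ^ 2) * (η / 2) *
          ((G t).im * (2 * (1 / (1 + (t / η) ^ 2) * (1 / η)))) =
          (G t).im * ((1 + (R / η) ^ 2) / (1 + (t / η) ^ 2)) := by
        field_simp
      rw [h4]
      refine le_mul_of_one_le_right (hpos _ (by simp)) ?_
      rw [one_le_div (by positivity)]
      linarith
    rw [intervalIntegral.integral_const_mul] at h2
    calc _ ≤ _ := h2
      _ ≤ (1 + (R / η) ^ 2) * (η / 2) * (2 * Real.pi * (G (η * Complex.I)).im) := by gcongr
      _ = (1 + (R / η) ^ 2) * (Real.pi * (η * (G (η * Complex.I)).im)) := by ring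
      _ ≤ _ := by
        have := Real.pi_pos
        gcongr
        exact hC η hη
  have hlim : Tendsto (fun η : ℝ => (1 + (R / η) ^ 2) * (Real.pi * C)) atTop
      (𝓝 ((1 + 0 ^ 2) * (Real.pi * C))) :=
    (((tendsto_const_nhds.div_atTop tendsto_id).pow 2).const_add 1).mul_const _
  have := ge_of_tendsto hlim ((eventually_gt_atTop 0).mono key)
  simpa using this

end HalfPlane

/-! ### Bounded inverses of a self-adjoint operator plus a bounded one -/

section Operators

open scoped InnerProductSpace

variable {H : Type*} [NormedAddCommGroup H] [InnerProductSpace ℂ H]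

theorem IsBoundedInverse.boundedInverse {S : H →ₗ.[ℂ] H} (h : ∃ R, IsBoundedInverse S R) :
    IsBoundedInverse S (boundedInverse S) := by
  obtain ⟨R, hR⟩ := h
  rwa [hR.boundedInverse_eq]

/-- The sum `A + D` of an unbounded operator and a bounded one, with domain `D(A)`. -/
noncomputable abbrev addBounded (A : H →ₗ.[ℂ] H) (D : H →L[ℂ] H) : H →ₗ.[ℂ] H :=
  (D : H →ₗ[ℂ] H) +ᵥ A

theorem addBounded_apply (A : H →ₗ.[ℂ] H) (D : H →L[ℂ] H) (x : H) (h : x ∈ A.domain) :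
    addBounded A D ⟨x, h⟩ = D x + A ⟨x, h⟩ := rfl

/-- The second resolvent identity. -/
theorem IsBoundedInverse.sub_apply {A : H →ₗ.[ℂ] H} {D D' R R' : H →L[ℂ] H}
    (hR : IsBoundedInverse (addBounded A D) R) (hR' : IsBoundedInverse (addBounded A D') R')
    (y : H) : R' y - R y = R ((D - D') (R' y)) := by
  obtain ⟨h, hy⟩ := hR'.1 y
  have h1 : R (D (R' y) + A ⟨R' y, h⟩) = R' y := hR.2 ⟨R' y, h⟩
  have h2 : D' (R' y) + A ⟨R' y, h⟩ = y := hy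
  nth_rw 1 [← h1]
  nth_rw 3 [← h2]
  rw [← map_sub, _root_.sub_apply]
  congr 1
  abel

variable [CompleteSpace H] {A : H →ₗ.[ℂ] H} {D : H →L[ℂ] H}

theorem IsSelfAdjoint.inner_apply_left (hA : IsSelfAdjoint A) (x y : A.domain) :
    ⟪A x, y⟫_ℂ = ⟪(x : H), A y⟫_ℂ := by
  have h := LinearPMap.adjoint_isFormalAdjoint hA.dense_domain
  rw [LinearPMap.isSelfAdjoint_def.1 hA] at h
  exact h x y

/-- Maximality of the domain: a vector satisfying the adjoint relation weakly lies in `D(A*) =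
D(A)`. This supplies both closedness of `A` and the description of the orthogonal complement of a
range. -/
theorem IsSelfAdjoint.exists_apply_eq (hA : IsSelfAdjoint A) {x y : H}
    (h : ∀ z : A.domain, ⟪y, (z : H)⟫_ℂ = ⟪x, A z⟫_ℂ) : ∃ hx : x ∈ A.domain, A ⟨x, hx⟩ = y := by
  have hx := A.mem_adjoint_domain_of_exists x ⟨y, h⟩
  have hy := LinearPMap.adjoint_apply_eq hA.dense_domain ⟨x, hx⟩ h
  have hA' := LinearPMap.isSelfAdjoint_def.1 hA
  generalize A.adjoint = T at hx hy hA'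
  subst hA'
  exact ⟨hx, hy⟩

theorem IsSelfAdjoint.im_inner_apply_self (hA : IsSelfAdjoint A) (x : A.domain) :
    (⟪(x : H), A x⟫_ℂ).im = 0 := by
  have h := inner_conj_symm (𝕜 := ℂ) (x : H) (A x)
  rw [hA.inner_apply_left] at h
  exact Complex.conj_eq_iff_im.1 h

theorem im_inner_addBounded (hA : IsSelfAdjoint A) (x : A.domain) :
    (⟪(x : H), addBounded A D x⟫_ℂ).im = (⟪(x : H), D x⟫_ℂ).im := by
  have h := addBounded_apply A D x x.2
  rw [Subtype.coe_eta] at h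
  rw [h, inner_add_right, Complex.add_im, hA.im_inner_apply_self, add_zero]

/-- The symmetric part `A` drops out of `Im ⟨x, (A + D)x⟩`; Cauchy–Schwarz does the rest. -/
theorem norm_le_norm_addBounded (hA : IsSelfAdjoint A)
    (hD : ∀ x : H, ‖x‖ ^ 2 ≤ |(⟪x, D x⟫_ℂ).im|) (x : A.domain) :
    ‖(x : H)‖ ≤ ‖addBounded A D x‖ := by
  have h : ‖(x : H)‖ ^ 2 ≤ ‖(x : H)‖ * ‖addBounded A D x‖ := by
    refine (hD x).trans ?_
    rw [← im_inner_addBounded hA]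
    exact (Complex.abs_im_le_norm _).trans (norm_inner_le_norm _ _)
  rcases (norm_nonneg (x : H)).eq_or_lt with h0 | h0
  · rw [← h0]
    exact norm_nonneg _
  · rw [sq] at h
    exact le_of_mul_le_mul_left h h0

/-- The lower bound makes preimages of a convergent sequence Cauchy, and `A`, being its own adjoint,
is closed. -/
theorem isClosed_range_addBounded (hA : IsSelfAdjoint A)
    (hD : ∀ x : H, ‖x‖ ^ 2 ≤ |(⟪x, D x⟫_ℂ).im|) :
    IsClosed (LinearMap.range (addBounded A D).toFun : Set H) := by
  refine IsSeqClosed.isClosed fun u y hu hy => ?_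
  choose x hx using hu
  have hx' : ∀ n, addBounded A D (x n) = u n := hx
  have hcs : CauchySeq fun n => (x n : H) := by
    have hcu := hy.cauchySeq
    rw [Metric.cauchySeq_iff'] at hcu ⊢
    intro ε hε
    obtain ⟨N, hN⟩ := hcu ε hε
    refine ⟨N, fun n hn => lt_of_le_of_lt ?_ (hN n hn)⟩
    rw [dist_eq_norm, dist_eq_norm, ← hx' n, ← hx' N, ← LinearPMap.map_sub]
    exact norm_le_norm_addBounded hA hD (x n - x N)
  obtain ⟨z, hz⟩ := cauchySeq_tendsto_of_complete hcs
  have hAx : ∀ n, A (x n) = u n - D (x n) := fun n => by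
    rw [← hx' n]
    exact (add_sub_cancel_left _ _).symm
  have hlim : Filter.Tendsto (fun n => A (x n)) Filter.atTop (nhds (y - D z)) := by
    simp only [hAx]
    exact hy.sub ((D.continuous.tendsto z).comp hz)
  obtain ⟨hmem, hAz⟩ := hA.exists_apply_eq (x := z) (y := y - D z) fun w => by
    have h1 : Filter.Tendsto (fun n => ⟪A (x n), (w : H)⟫_ℂ) Filter.atTop
        (nhds ⟪y - D z, (w : H)⟫_ℂ) := hlim.inner tendsto_const_nhds
    have h2 : Filter.Tendsto (fun n => ⟪(x n : H), A w⟫_ℂ) Filter.atTop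
        (nhds ⟪z, A w⟫_ℂ) := hz.inner tendsto_const_nhds
    refine tendsto_nhds_unique h1 (h2.congr fun n => ?_)
    exact (hA.inner_apply_left (x n) w).symm
  refine ⟨⟨z, hmem⟩, ?_⟩
  change D z + A ⟨z, hmem⟩ = y
  rw [hAz, add_sub_cancel]

/-- A vector `x` orthogonal to the range satisfies `A x = -D* x`. Since `⟨x, A x⟩` is real, `Im ⟨x,
D x⟩ = 0`, forcing `x = 0`. -/
theorem range_addBounded (hA : IsSelfAdjoint A) (hD : ∀ x : H, ‖x‖ ^ 2 ≤ |(⟪x, D x⟫_ℂ).im|) :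
    LinearMap.range (addBounded A D).toFun = ⊤ := by
  have hcl := isClosed_range_addBounded hA hD
  have : CompleteSpace (LinearMap.range (addBounded A D).toFun) := hcl.completeSpace_coe
  rw [← Submodule.orthogonal_eq_bot_iff, Submodule.eq_bot_iff]
  intro x hx
  have hx' : ∀ z : A.domain, ⟪D z + A z, x⟫_ℂ = 0 := fun z =>
    (Submodule.mem_orthogonal _ x).1 hx _ ⟨z, rfl⟩
  obtain ⟨hmem, hAx⟩ := hA.exists_apply_eq (x := x) (y := -D.adjoint x) fun z => by
    have h := congrArg (starRingEnd ℂ) (hx' z)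
    rw [inner_conj_symm, map_zero, inner_add_right] at h
    rw [inner_neg_left, ContinuousLinearMap.adjoint_inner_left]
    exact neg_eq_of_add_eq_zero_right h
  have h0 := hA.im_inner_apply_self ⟨x, hmem⟩
  rw [hAx, inner_neg_right, ContinuousLinearMap.adjoint_inner_right, Complex.neg_im,
    neg_eq_zero, ← inner_conj_symm, Complex.conj_im, neg_eq_zero] at h0
  have h1 := hD x
  rw [h0, abs_zero] at h1
  exact norm_eq_zero.1 (pow_eq_zero_iff two_ne_zero |>.1 (le_antisymm h1 (sq_nonneg _)))

/-- If `A` is self-adjoint and the imaginary part of `D` is bounded below by one, then `A + D` has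
an everywhere defined bounded inverse, of norm at most one. -/
theorem exists_isBoundedInverse_addBounded (hA : IsSelfAdjoint A)
    (hD : ∀ x : H, ‖x‖ ^ 2 ≤ |(⟪x, D x⟫_ℂ).im|) :
    ∃ R, IsBoundedInverse (addBounded A D) R := by
  have hker : LinearMap.ker (addBounded A D).toFun = ⊥ := by
    rw [LinearMap.ker_eq_bot']
    intro x hx
    have h := norm_le_norm_addBounded hA hD x
    rw [show addBounded A D x = 0 from hx, norm_zero, norm_le_zero_iff] at h
    exact Subtype.ext h
  let e : A.domain ≃ₗ[ℂ] H := LinearEquiv.ofBijective (addBounded A D).toFun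
    ⟨LinearMap.ker_eq_bot.1 hker, LinearMap.range_eq_top.1 (range_addBounded hA hD)⟩
  have he : ∀ x : A.domain, addBounded A D x = e x := fun x => rfl
  refine ⟨(A.domain.subtype ∘ₗ e.symm.toLinearMap).mkContinuous 1 fun y => ?_, fun y => ?_,
    fun x => ?_⟩
  · have h := norm_le_norm_addBounded hA hD (e.symm y)
    rw [he, e.apply_symm_apply] at h
    simpa using h
  · exact ⟨(e.symm y).2, (he _).trans (e.apply_symm_apply y)⟩
  · change ((e.symm (addBounded A D x) : A.domain) : H) = x
    rw [he, e.symm_apply_apply]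

theorem IsBoundedInverse.norm_apply_le {R : H →L[ℂ] H} (hA : IsSelfAdjoint A)
    (hD : ∀ x : H, ‖x‖ ^ 2 ≤ |(⟪x, D x⟫_ℂ).im|) (hR : IsBoundedInverse (addBounded A D) R)
    (y : H) : ‖R y‖ ≤ ‖y‖ := by
  obtain ⟨h, hy⟩ := hR.1 y
  have := norm_le_norm_addBounded hA hD ⟨R y, h⟩
  rwa [hy] at this

end Operators

/-! ### From integrals to sums of suprema -/

section Averaging

open intervalIntegral

variable {f f' : ℝ → ℝ} {b : ℝ}

/-- A function whose logarithmic derivative is at most `b` is bounded on an interval of length one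
by `1 + b` times its integral. -/
theorem le_one_add_mul_integral (hf : ∀ t, HasDerivAt f (f' t) t) (h0 : ∀ t, 0 ≤ f t)
    (hb : 0 ≤ b) (hf' : ∀ t, |f' t| ≤ b * f t) (a : ℝ) {y : ℝ} (hy : y ∈ Set.Icc a (a + 1)) :
    f y ≤ (1 + b) * ∫ t in a..a + 1, f t := by
  have hc : Continuous f := continuous_iff_continuousAt.2 fun t => (hf t).continuousAt
  have hi : ∀ u v, IntervalIntegrable f MeasureTheory.volume u v := hc.intervalIntegrable
  have hI : ∀ t, HasDerivAt (fun s => b * ∫ u in a..s, f u) (b * f t) t := fun t =>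
    (integral_hasDerivAt_right (hi a t) (hc.stronglyMeasurableAtFilter _ _) hc.continuousAt).const_mul b
  -- The two one-sided bounds on `f'` control `f s` from below by `f y`, for `s ≤ y` and `s ≥ y`
  -- respectively; averaging over `s` in the unit interval then gives the claim.
  have hanti : Antitone fun s => f s - b * ∫ u in a..s, f u :=
    antitone_of_hasDerivAt_nonpos (fun t => (hf t).sub (hI t)) fun t =>
      sub_nonpos.2 ((le_abs_self _).trans (hf' t))
  have hmono : Monotone fun s => f s + b * ∫ u in a..s, f u :=
    monotone_of_hasDerivAt_nonneg (fun t => (hf t).add (hI t)) fun t => by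
      have := (neg_abs_le (f' t)).trans' (neg_le_neg (hf' t))
      show 0 ≤ f' t + b * f t
      linarith
  have hle : ∀ u v, a ≤ u → u ≤ v → v ≤ a + 1 →
      0 ≤ ∫ t in a..u, f t ∧ (∫ t in a..u, f t) ≤ ∫ t in a..v, f t ∧
      (∫ t in a..v, f t) ≤ ∫ t in a..a + 1, f t := fun u v hau huv hv =>
    ⟨integral_nonneg_of_forall hau h0,
      integral_mono_interval le_rfl hau huv (Filter.Eventually.of_forall h0) (hi _ _),
      integral_mono_interval le_rfl (hau.trans huv) hv (Filter.Eventually.of_forall h0) (hi _ _)⟩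
  have key : ∀ s ∈ Set.Icc a (a + 1), f y - b * (∫ t in a..a + 1, f t) ≤ f s := by
    intro s hs
    rcases le_total s y with h | h
    · obtain ⟨h1, h2, h3⟩ := hle s y hs.1 h hy.2
      have h4 : f y - b * (∫ u in a..y, f u) ≤ f s - b * ∫ u in a..s, f u := hanti h
      have h5 := mul_nonneg hb h1
      have h6 := mul_le_mul_of_nonneg_left h3 hb
      linarith
    · obtain ⟨h1, h2, h3⟩ := hle y s hy.1 h hs.2
      have h4 : f y + b * (∫ u in a..y, f u) ≤ f s + b * ∫ u in a..s, f u := hmono h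
      have h5 := mul_nonneg hb h1
      have h6 := mul_le_mul_of_nonneg_left h3 hb
      linarith
  have h := integral_mono_on (by linarith) _root_.intervalIntegrable_const (hi a (a + 1)) key
  rw [integral_const, add_sub_cancel_left, one_smul] at h
  linarith

theorem sum_Ico_integral_int (hf : Continuous f) (N : ℕ) :
    ∑ n ∈ Finset.Ico (-(N : ℤ)) N, ∫ t in (n : ℝ)..n + 1, f t = ∫ t in -(N : ℝ)..N, f t := by
  have hi : ∀ u v, IntervalIntegrable f MeasureTheory.volume u v := hf.intervalIntegrable
  induction N with
  | zero => simp
  | succ N ih =>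
    have h1 : Finset.Ico (-((N + 1 : ℕ) : ℤ)) (N + 1 : ℕ) =
        insert (-(N : ℤ) - 1) (insert (N : ℤ) (Finset.Ico (-(N : ℤ)) N)) := by
      ext n
      simp only [Finset.mem_insert, Finset.mem_Ico]
      omega
    rw [h1, Finset.sum_insert (by simp), Finset.sum_insert (by simp), ih]
    push_cast
    rw [add_comm (∫ t in (N : ℝ)..N + 1, f t), integral_add_adjacent_intervals (hi _ _) (hi _ _),
      sub_add_cancel, integral_add_adjacent_intervals (hi _ _) (hi _ _)]
    congr 1
    ring

theorem summable_iSup_and_tsum_le (hf : ∀ t, HasDerivAt f (f' t) t) (h0 : ∀ t, 0 ≤ f t)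
    (hb : 0 ≤ b) (hf' : ∀ t, |f' t| ≤ b * f t) {K : ℝ}
    (hK : ∀ R : ℝ, 0 < R → ∫ t in -R..R, f t ≤ K) :
    (∀ n : ℤ, BddAbove (Set.range fun y : Set.Icc (0 : ℝ) 1 => f ((n : ℝ) + (y : ℝ)))) ∧
    (Summable fun n : ℤ => ⨆ y : Set.Icc (0 : ℝ) 1, f ((n : ℝ) + (y : ℝ))) ∧
    ∑' n : ℤ, ⨆ y : Set.Icc (0 : ℝ) 1, f ((n : ℝ) + (y : ℝ)) ≤ (1 + b) * K := by
  have hc : Continuous f := continuous_iff_continuousAt.2 fun t => (hf t).continuousAt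
  have hle : ∀ (n : ℤ) (y : Set.Icc (0 : ℝ) 1),
      f ((n : ℝ) + (y : ℝ)) ≤ (1 + b) * ∫ t in (n : ℝ)..n + 1, f t := fun n y =>
    le_one_add_mul_integral hf h0 hb hf' n ⟨by linarith [y.2.1], by linarith [y.2.2]⟩
  have hsup0 : ∀ n : ℤ, 0 ≤ ⨆ y : Set.Icc (0 : ℝ) 1, f ((n : ℝ) + (y : ℝ)) := fun n =>
    Real.iSup_nonneg fun y => h0 _
  have hsum : ∀ s : Finset ℤ,
      ∑ n ∈ s, ⨆ y : Set.Icc (0 : ℝ) 1, f ((n : ℝ) + (y : ℝ)) ≤ (1 + b) * K := by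
    intro s
    obtain ⟨N, hN⟩ : ∃ N : ℕ, ∀ n ∈ s, n.natAbs ≤ N :=
      ⟨s.sup Int.natAbs, fun n hn => Finset.le_sup (f := Int.natAbs) hn⟩
    -- `N + 1` rather than `N`, because the interval is half-open and must contain `N`.
    have hsub : s ⊆ Finset.Ico (-((N + 1 : ℕ) : ℤ)) (N + 1 : ℕ) := fun n hn => by
      have := hN n hn
      rw [Finset.mem_Ico]
      omega
    calc _ ≤ ∑ n ∈ Finset.Ico (-((N + 1 : ℕ) : ℤ)) (N + 1 : ℕ),
          ⨆ y : Set.Icc (0 : ℝ) 1, f ((n : ℝ) + (y : ℝ)) :=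
          Finset.sum_le_sum_of_subset_of_nonneg hsub fun n _ _ => hsup0 n
      _ ≤ ∑ n ∈ Finset.Ico (-((N + 1 : ℕ) : ℤ)) (N + 1 : ℕ),
          (1 + b) * ∫ t in (n : ℝ)..n + 1, f t :=
          Finset.sum_le_sum fun n _ => ciSup_le (hle n)
      _ = (1 + b) * ∫ t in -((N + 1 : ℕ) : ℝ)..(N + 1 : ℕ), f t := by
          rw [← Finset.mul_sum, sum_Ico_integral_int hc]
      _ ≤ (1 + b) * K := by
          gcongr
          exact hK _ (by positivity)
  refine ⟨fun n => ⟨_, Set.forall_mem_range.2 (hle n)⟩, summable_of_sum_le hsup0 hsum, ?_⟩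
  exact (summable_of_sum_le hsup0 hsum).tsum_le_of_sum_le hsum

end Averaging

/-! ### The resolvent as a function of the coupling constant -/

section Family

open scoped InnerProductSpace

variable {H : Type*} [NormedAddCommGroup H] [InnerProductSpace ℂ H]

/-- Factor `T² + 1 = (T - c)(T + c)` with `c² = -1`. Allowing both `c = i` and `c = -i` yields the
inverse as a product in either order. -/
theorem isBoundedInverse_sqAddOne {T : H →ₗ.[ℂ] H} {c : ℂ} (hc : c * c = -1) {R R' : H →L[ℂ] H}
    (hR : IsBoundedInverse (addBounded T (c • ContinuousLinearMap.id ℂ H)) R)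
    (hR' : IsBoundedInverse (addBounded T (-c • ContinuousLinearMap.id ℂ H)) R') :
    IsBoundedInverse (sqAddOne T) (R ∘L R') := by
  constructor
  · intro y
    obtain ⟨h1, hy1⟩ := hR.1 (R' y)
    obtain ⟨h2, hy2⟩ := hR'.1 y
    have e1 : T ⟨R (R' y), h1⟩ = R' y - c • R (R' y) := eq_sub_of_add_eq' hy1
    have e2 : T ⟨R' y, h2⟩ = y - (-c) • R' y := eq_sub_of_add_eq' hy2
    have hmem : T ⟨R (R' y), h1⟩ ∈ T.domain := by
      rw [e1]
      exact T.domain.sub_mem h2 (T.domain.smul_mem c h1)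
    have e3 : T ⟨T ⟨R (R' y), h1⟩, hmem⟩ = T ⟨R' y, h2⟩ - c • T ⟨R (R' y), h1⟩ := by
      rw [← T.map_smul, ← T.map_sub]
      congr 1
      exact Subtype.ext e1
    refine ⟨⟨h1, hmem⟩, ?_⟩
    change R (R' y) + T ⟨T ⟨R (R' y), h1⟩, hmem⟩ = y
    rw [e3, e1, e2, smul_sub, smul_smul, hc]
    module
  · rintro ⟨x, h1, h2⟩
    change R (R' (x + T ⟨T ⟨x, h1⟩, h2⟩)) = x
    have hmem : T ⟨x, h1⟩ + c • x ∈ T.domain := T.domain.add_mem h2 (T.domain.smul_mem c h1)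
    have e1 : R' (-c • (T ⟨x, h1⟩ + c • x) + T ⟨T ⟨x, h1⟩ + c • x, hmem⟩) =
        T ⟨x, h1⟩ + c • x := hR'.2 ⟨_, hmem⟩
    have e2 : R (c • x + T ⟨x, h1⟩) = x := hR.2 ⟨x, h1⟩
    have e3 : T ⟨T ⟨x, h1⟩ + c • x, hmem⟩ = T ⟨T ⟨x, h1⟩, h2⟩ + c • T ⟨x, h1⟩ := by
      rw [← T.map_smul, ← T.map_add]
      rfl
    have e4 : x + T ⟨T ⟨x, h1⟩, h2⟩ =
        -c • (T ⟨x, h1⟩ + c • x) + T ⟨T ⟨x, h1⟩ + c • x, hmem⟩ := by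
      rw [e3, smul_add, smul_smul, neg_mul, hc]
      module
    rw [e4, e1, add_comm, e2]

theorem addBounded_perturbedOperator (A : H →ₗ.[ℂ] H) (B : H →L[ℂ] H) (t : ℝ) (c : ℂ) :
    addBounded (perturbedOperator A B t) (c • ContinuousLinearMap.id ℂ H) =
      addBounded A ((t : ℂ) • B + c • ContinuousLinearMap.id ℂ H) := by
  rw [addBounded, perturbedOperator, vadd_vadd, addBounded, add_comm]
  rfl

/-- The resolvent `(A + w B + i)⁻¹`. -/
noncomputable def couplingResolvent (A : H →ₗ.[ℂ] H) (B : H →L[ℂ] H) (w : ℂ) : H →L[ℂ] H :=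
  boundedInverse (addBounded A (w • B + Complex.I • ContinuousLinearMap.id ℂ H))

/-- The resolvent `(A + w B - i)⁻¹`. -/
noncomputable def conjCouplingResolvent (A : H →ₗ.[ℂ] H) (B : H →L[ℂ] H) (w : ℂ) : H →L[ℂ] H :=
  boundedInverse (addBounded A (w • B + -Complex.I • ContinuousLinearMap.id ℂ H))

/-- The matrix element `-⟨v, (A + w B + i)⁻¹ v⟩`, as a function of the coupling constant `w`. -/
noncomputable def couplingElement (A : H →ₗ.[ℂ] H) (B : H →L[ℂ] H) (v : H) (w : ℂ) : ℂ :=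
  -⟪v, couplingResolvent A B w v⟫_ℂ

variable {A : H →ₗ.[ℂ] H} {B : H →L[ℂ] H}

theorem ContinuousLinearMap.IsPositive.im_inner_apply_self (hB : B.IsPositive) (x : H) :
    (⟪x, B x⟫_ℂ).im = 0 := by
  have h := inner_conj_symm (𝕜 := ℂ) x (B x)
  rw [show ⟪B x, x⟫_ℂ = ⟪x, B x⟫_ℂ from hB.isSymmetric x x] at h
  exact Complex.conj_eq_iff_im.1 h

theorem ContinuousLinearMap.IsPositive.re_inner_apply_self_nonneg (hB : B.IsPositive) (x : H) :
    0 ≤ (⟪x, B x⟫_ℂ).re := hB.re_inner_nonneg_right x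

theorem im_inner_coupling (hB : B.IsPositive) (w c : ℂ) (x : H) :
    (⟪x, (w • B + c • ContinuousLinearMap.id ℂ H) x⟫_ℂ).im =
      w.im * (⟪x, B x⟫_ℂ).re + c.im * ‖x‖ ^ 2 := by
  have h : (w • B + c • ContinuousLinearMap.id ℂ H) x = w • B x + c • x := rfl
  rw [h, inner_add_right, inner_smul_right, inner_smul_right, Complex.add_im, Complex.mul_im,
    Complex.mul_im, hB.im_inner_apply_self, inner_self_eq_norm_sq_to_K]
  simp [← Complex.ofReal_pow]

/-- For `+i` the contributions of `Im w` and of `i` have the same sign. For `-i` they would compete,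
so the conjugate resolvent is used only at real coupling. -/
theorem norm_sq_le_abs_im_inner_coupling (hB : B.IsPositive) {w : ℂ} (hw : 0 ≤ w.im) (x : H) :
    ‖x‖ ^ 2 ≤ |(⟪x, (w • B + Complex.I • ContinuousLinearMap.id ℂ H) x⟫_ℂ).im| := by
  refine le_trans ?_ (le_abs_self _)
  rw [im_inner_coupling hB, Complex.I_im, one_mul]
  have := mul_nonneg hw (hB.re_inner_apply_self_nonneg x)
  linarith

theorem norm_sq_le_abs_im_inner_conjCoupling (hB : B.IsPositive) (t : ℝ) (x : H) :
    ‖x‖ ^ 2 ≤ |(⟪x, ((t : ℂ) • B + -Complex.I • ContinuousLinearMap.id ℂ H) x⟫_ℂ).im| := by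
  rw [im_inner_coupling hB]
  simp

variable [CompleteSpace H]

theorem isBoundedInverse_couplingResolvent (hA : IsSelfAdjoint A) (hB : B.IsPositive) {w : ℂ}
    (hw : 0 ≤ w.im) :
    IsBoundedInverse (addBounded A (w • B + Complex.I • ContinuousLinearMap.id ℂ H))
      (couplingResolvent A B w) :=
  IsBoundedInverse.boundedInverse
    (exists_isBoundedInverse_addBounded hA (norm_sq_le_abs_im_inner_coupling hB hw))

theorem isBoundedInverse_conjCouplingResolvent (hA : IsSelfAdjoint A) (hB : B.IsPositive) (t : ℝ) :
    IsBoundedInverse (addBounded A ((t : ℂ) • B + -Complex.I • ContinuousLinearMap.id ℂ H))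
      (conjCouplingResolvent A B t) :=
  IsBoundedInverse.boundedInverse
    (exists_isBoundedInverse_addBounded hA (norm_sq_le_abs_im_inner_conjCoupling hB t))

theorem isBoundedInverse_comp_conj (hA : IsSelfAdjoint A) (hB : B.IsPositive) (t : ℝ) :
    IsBoundedInverse (sqAddOne (perturbedOperator A B t))
      (couplingResolvent A B t ∘L conjCouplingResolvent A B t) := by
  refine isBoundedInverse_sqAddOne Complex.I_mul_I ?_ ?_
  · rw [addBounded_perturbedOperator]
    exact isBoundedInverse_couplingResolvent hA hB (by simp)
  · rw [addBounded_perturbedOperator]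
    exact isBoundedInverse_conjCouplingResolvent hA hB t

theorem isBoundedInverse_conj_comp (hA : IsSelfAdjoint A) (hB : B.IsPositive) (t : ℝ) :
    IsBoundedInverse (sqAddOne (perturbedOperator A B t))
      (conjCouplingResolvent A B t ∘L couplingResolvent A B t) := by
  refine isBoundedInverse_sqAddOne (c := -Complex.I) (by simp) ?_ ?_
  · rw [addBounded_perturbedOperator]
    exact isBoundedInverse_conjCouplingResolvent hA hB t
  · rw [addBounded_perturbedOperator, neg_neg]
    exact isBoundedInverse_couplingResolvent hA hB (by simp)

theorem inner_conjCouplingResolvent (hA : IsSelfAdjoint A) (hB : B.IsPositive) (t : ℝ) (u v : H) :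
    ⟪conjCouplingResolvent A B t u, v⟫_ℂ = ⟪u, couplingResolvent A B t v⟫_ℂ := by
  obtain ⟨h1, hu⟩ := (isBoundedInverse_conjCouplingResolvent hA hB t).1 u
  obtain ⟨h2, hv⟩ := (isBoundedInverse_couplingResolvent hA hB (w := t) (by simp)).1 v
  set x := conjCouplingResolvent A B t u
  set y := couplingResolvent A B t v
  have hu' : ((t : ℂ) • B x + -Complex.I • x) + A ⟨x, h1⟩ = u := hu
  have hv' : ((t : ℂ) • B y + Complex.I • y) + A ⟨y, h2⟩ = v := hv
  have hsymm : ⟪A ⟨x, h1⟩, y⟫_ℂ = ⟪x, A ⟨y, h2⟩⟫_ℂ := hA.inner_apply_left ⟨x, h1⟩ ⟨y, h2⟩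
  have hBs : ⟪B x, y⟫_ℂ = ⟪x, B y⟫_ℂ := hB.isSymmetric x y
  rw [← hu', ← hv']
  simp only [inner_add_left, inner_add_right, inner_smul_left, inner_smul_right, hsymm, hBs,
    map_neg, Complex.conj_I, Complex.conj_ofReal, neg_neg]

theorem norm_couplingResolvent_apply_le (hA : IsSelfAdjoint A) (hB : B.IsPositive) {w : ℂ}
    (hw : 0 ≤ w.im) (v : H) : ‖couplingResolvent A B w v‖ ≤ ‖v‖ :=
  (isBoundedInverse_couplingResolvent hA hB hw).norm_apply_le hA
    (norm_sq_le_abs_im_inner_coupling hB hw) v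

theorem couplingResolvent_sub_apply (hA : IsSelfAdjoint A) (hB : B.IsPositive) {w w' : ℂ}
    (hw : 0 ≤ w.im) (hw' : 0 ≤ w'.im) (v : H) :
    couplingResolvent A B w' v - couplingResolvent A B w v =
      (w' - w) • -couplingResolvent A B w (B (couplingResolvent A B w' v)) := by
  rw [(isBoundedInverse_couplingResolvent hA hB hw).sub_apply
    (isBoundedInverse_couplingResolvent hA hB hw') v, add_sub_add_right_eq_sub, ← sub_smul,
    _root_.smul_apply, map_smul, smul_neg, ← neg_smul, neg_sub]

open Filter Topology in
theorem continuousOn_couplingResolvent_apply (hA : IsSelfAdjoint A) (hB : B.IsPositive) (v : H) :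
    ContinuousOn (fun w => couplingResolvent A B w v) {w | 0 ≤ w.im} := by
  intro w hw
  rw [ContinuousWithinAt, tendsto_iff_norm_sub_tendsto_zero]
  have hlim : Tendsto (fun w' : ℂ => ‖w' - w‖ * (‖B‖ * ‖v‖)) (𝓝[{w | 0 ≤ w.im}] w) (𝓝 0) := by
    have : Continuous fun w' : ℂ => ‖w' - w‖ * (‖B‖ * ‖v‖) := by fun_prop
    simpa using (this.tendsto w).mono_left nhdsWithin_le_nhds
  refine squeeze_zero' (Eventually.of_forall fun _ => norm_nonneg _) ?_ hlim
  filter_upwards [self_mem_nhdsWithin] with w' hw'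
  rw [couplingResolvent_sub_apply hA hB hw hw', norm_smul, norm_neg]
  gcongr
  refine (norm_couplingResolvent_apply_le hA hB hw _).trans ((B.le_opNorm _).trans ?_)
  gcongr
  exact norm_couplingResolvent_apply_le hA hB hw' v

-- The second resolvent identity gives the slope exactly. Working within the closed half-plane
-- provides holomorphy inside and the real derivative on the boundary at once.
open Filter Topology in
theorem hasDerivWithinAt_couplingElement (hA : IsSelfAdjoint A) (hB : B.IsPositive) (v : H)
    {w : ℂ} (hw : 0 ≤ w.im) :
    HasDerivWithinAt (couplingElement A B v)
      ⟪v, couplingResolvent A B w (B (couplingResolvent A B w v))⟫_ℂ {w | 0 ≤ w.im} w := by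
  rw [hasDerivWithinAt_iff_tendsto_slope]
  have h : Tendsto (fun w' => ⟪v, couplingResolvent A B w (B (couplingResolvent A B w' v))⟫_ℂ)
      (𝓝[{w | 0 ≤ w.im} \ {w}] w)
      (𝓝 ⟪v, couplingResolvent A B w (B (couplingResolvent A B w v))⟫_ℂ) := by
    have h1 : Tendsto (fun w' => couplingResolvent A B w' v) (𝓝[{w | 0 ≤ w.im} \ {w}] w)
        (𝓝 (couplingResolvent A B w v)) :=
      (continuousOn_couplingResolvent_apply hA hB v w hw).mono_left
        (nhdsWithin_mono _ Set.sdiff_subset)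
    exact tendsto_const_nhds.inner
      ((((couplingResolvent A B w).continuous.comp B.continuous).tendsto _).comp h1)
  refine h.congr' ?_
  filter_upwards [self_mem_nhdsWithin] with w' hw'
  have hne : w' - w ≠ 0 := sub_ne_zero.2 hw'.2
  rw [slope_def_module, couplingElement, couplingElement, neg_sub_neg, ← inner_sub_right,
    ← neg_sub (couplingResolvent A B w' v), couplingResolvent_sub_apply hA hB hw hw'.1, ← smul_neg, neg_neg, inner_smul_right,
    smul_eq_mul, inv_mul_cancel_left₀ hne]

/-- With `x = (A + wB + i)⁻¹ v`, write `v = (A + wB + i)x` in `⟨x, v⟩`; `A` contributes only a real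
term. -/
theorem im_couplingElement (hA : IsSelfAdjoint A) (hB : B.IsPositive) (v : H) {w : ℂ}
    (hw : 0 ≤ w.im) :
    (couplingElement A B v w).im =
      w.im * (⟪couplingResolvent A B w v, B (couplingResolvent A B w v)⟫_ℂ).re +
        ‖couplingResolvent A B w v‖ ^ 2 := by
  obtain ⟨h, hv⟩ := (isBoundedInverse_couplingResolvent hA hB hw).1 v
  have h1 := im_inner_addBounded
    (D := w • B + Complex.I • ContinuousLinearMap.id ℂ H) hA ⟨couplingResolvent A B w v, h⟩
  rw [hv, im_inner_coupling hB, Complex.I_im, one_mul] at h1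
  rw [couplingElement, ← h1, ← inner_conj_symm, Complex.neg_im, Complex.conj_im, neg_neg]

theorem im_couplingElement_nonneg (hA : IsSelfAdjoint A) (hB : B.IsPositive) (v : H) {w : ℂ}
    (hw : 0 ≤ w.im) : 0 ≤ (couplingElement A B v w).im := by
  rw [im_couplingElement hA hB v hw]
  have := mul_nonneg hw (hB.re_inner_apply_self_nonneg (couplingResolvent A B w v))
  positivity

theorem mul_im_couplingElement_le (hA : IsSelfAdjoint A) (hB : B.IsPositive) (φ : H) {η : ℝ}
    (hη : 0 < η) :
    η * (couplingElement A B (B φ) (η * Complex.I)).im ≤ (⟪φ, B φ⟫_ℂ).re := by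
  have hw : 0 ≤ ((η : ℂ) * Complex.I).im := by simpa using hη.le
  have h1 := im_couplingElement hA hB (B φ) hw
  rw [couplingElement] at *
  set x := couplingResolvent A B (η * Complex.I) (B φ)
  -- Expanding `⟨y, B y⟩ ≥ 0` for `y = ηx + iφ` gives `2η Im F ≤ η²⟨x, Bx⟩ + ⟨φ, Bφ⟩`, while `h1`
  -- gives `η²⟨x, Bx⟩ ≤ η Im F`.
  have h2 := hB.re_inner_apply_self_nonneg ((η : ℂ) • x + Complex.I • φ)
  have hx : ⟪φ, B x⟫_ℂ = ⟪B φ, x⟫_ℂ := (hB.isSymmetric φ x).symm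
  have him : (⟪x, B φ⟫_ℂ).im = -(⟪B φ, x⟫_ℂ).im := by
    rw [← inner_conj_symm, Complex.conj_im]
  simp only [map_add, map_smul, inner_add_left, inner_add_right, inner_smul_left, inner_smul_right,
    hx, Complex.conj_I, Complex.conj_ofReal] at h2
  simp [him] at h1 h2 ⊢
  linarith [mul_nonneg hη.le (sq_nonneg ‖x‖), congrArg (η * ·) h1]

theorem averagingElement_eq (hA : IsSelfAdjoint A) (hB : B.IsPositive) (φ : H) (t : ℝ) :
    averagingElement A B φ t = ((couplingElement A B (B φ) t).im : ℂ) := by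
  rw [im_couplingElement hA hB _ (by simp), averagingElement, averagingResolvent,
    (isBoundedInverse_conj_comp hA hB t).boundedInverse_eq, ContinuousLinearMap.comp_apply]
  rw [← inner_conj_symm, inner_conjCouplingResolvent hA hB, inner_self_eq_norm_sq_to_K]
  simp [← Complex.ofReal_pow]

/-- Normality of the resolvent: both orders of the product invert `(A + tB)² + 1`, so uniqueness
makes the resolvent commute with its adjoint. -/
theorem norm_conjCouplingResolvent_apply (hA : IsSelfAdjoint A) (hB : B.IsPositive) (t : ℝ)
    (v : H) : ‖conjCouplingResolvent A B t v‖ = ‖couplingResolvent A B t v‖ := by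
  have h := congrArg (fun R : H →L[ℂ] H => ⟪R v, v⟫_ℂ)
    ((isBoundedInverse_comp_conj hA hB t).unique (isBoundedInverse_conj_comp hA hB t))
  simp only [ContinuousLinearMap.comp_apply, inner_conjCouplingResolvent hA hB] at h
  rw [← inner_conj_symm, ← inner_conjCouplingResolvent hA hB, inner_self_eq_norm_sq_to_K,
    inner_self_eq_norm_sq_to_K, map_pow, RCLike.conj_ofReal] at h
  have h' : ‖conjCouplingResolvent A B t v‖ ^ 2 = ‖couplingResolvent A B t v‖ ^ 2 := by
    exact_mod_cast h
  exact (pow_left_inj₀ (norm_nonneg _) (norm_nonneg _) two_ne_zero).1 h'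

theorem hasDerivAt_im_couplingElement (hA : IsSelfAdjoint A) (hB : B.IsPositive) (v : H) (t : ℝ) :
    HasDerivAt (fun s : ℝ => (couplingElement A B v s).im)
      (⟪v, couplingResolvent A B t (B (couplingResolvent A B t v))⟫_ℂ).im t := by
  have h1 : HasDerivWithinAt (fun s : ℝ => couplingElement A B v s)
      ((1 : ℂ) • ⟪v, couplingResolvent A B t (B (couplingResolvent A B t v))⟫_ℂ) Set.univ t :=
    (hasDerivWithinAt_couplingElement hA hB v (w := t) (by simp)).scomp t
      (Complex.ofRealCLM.hasDerivAt (x := t)).hasDerivWithinAt fun s _ => by simp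
  rw [one_smul, hasDerivWithinAt_univ] at h1
  exact Complex.imCLM.hasFDerivAt.comp_hasDerivAt t h1

/-- With `R = (A + tB + i)⁻¹` the derivative is `Im ⟨R* v, B R v⟩`, and normality gives `‖R* v‖ = ‖R
v‖`, whose square is `Im F(t)`. -/
theorem abs_deriv_im_couplingElement_le (hA : IsSelfAdjoint A) (hB : B.IsPositive) (v : H)
    (t : ℝ) :
    |(⟪v, couplingResolvent A B t (B (couplingResolvent A B t v))⟫_ℂ).im| ≤
      ‖B‖ * (couplingElement A B v t).im := by
  rw [im_couplingElement hA hB v (by simp), ← inner_conjCouplingResolvent hA hB, Complex.ofReal_im,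
    zero_mul, zero_add]
  refine (Complex.abs_im_le_norm _).trans ((norm_inner_le_norm _ _).trans ?_)
  rw [norm_conjCouplingResolvent_apply hA hB]
  calc _ ≤ ‖couplingResolvent A B t v‖ * (‖B‖ * ‖couplingResolvent A B t v‖) := by
        gcongr
        exact B.le_opNorm _
    _ = _ := by ring

/-- Spectral averaging. -/
theorem integral_im_couplingElement_le (hA : IsSelfAdjoint A) (hB : B.IsPositive) (φ : H) {R : ℝ}
    (hR : 0 < R) :
    ∫ t in -R..R, (couplingElement A B (B φ) t).im ≤ Real.pi * (⟪φ, B φ⟫_ℂ).re := by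
  have hd := fun (w : ℂ) (hw : 0 ≤ w.im) => hasDerivWithinAt_couplingElement hA hB (B φ) hw
  refine integral_im_le_of_upperHalfPlane (M := ‖B φ‖ * ‖B φ‖)
    (fun w hw => (hd w hw).continuousWithinAt) (fun w hw => ?_) (fun w hw => ?_)
    (fun w hw => im_couplingElement_nonneg hA hB _ hw)
    (fun η hη => mul_im_couplingElement_le hA hB φ hη) hR
  · have hw' : 0 < w.im := hw
    exact ((hd w hw'.le).mono fun z hz => (Set.mem_ofPred.1 hz).le).differentiableWithinAt
  · rw [couplingElement, norm_neg]
    refine (norm_inner_le_norm _ _).trans ?_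
    gcongr
    exact norm_couplingResolvent_apply_le hA hB hw _

end Family

/-- Discretized spectral averaging. The first three conjuncts say that the objects in the bound
make sense: the inverses exist as bounded operators, the matrix elements are real and
nonnegative, and the suprema are finite. -/
theorem mainTheorem6 {H : Type*} [NormedAddCommGroup H] [InnerProductSpace ℂ H] [CompleteSpace H]
    [TopologicalSpace.SeparableSpace H] (A : H →ₗ.[ℂ] H) (hA : IsSelfAdjoint A)
    (B : H →L[ℂ] H) (hB : B.IsPositive) (φ : H) :
    (∀ t : ℝ, IsBoundedInverse (sqAddOne (perturbedOperator A B t)) (averagingResolvent A B t)) ∧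
    (∀ t : ℝ, (averagingElement A B φ t).im = 0 ∧ 0 ≤ (averagingElement A B φ t).re) ∧
    (∀ n : ℤ, BddAbove (Set.range fun y : Set.Icc (0 : ℝ) 1 =>
      (averagingElement A B φ ((n : ℝ) + (y : ℝ))).re)) ∧
    (Summable fun n : ℤ => ⨆ y : Set.Icc (0 : ℝ) 1,
      (averagingElement A B φ ((n : ℝ) + (y : ℝ))).re) ∧
    ∑' n : ℤ, ⨆ y : Set.Icc (0 : ℝ) 1, (averagingElement A B φ ((n : ℝ) + (y : ℝ))).re
      ≤ Real.pi * ‖B‖ * (1 + ‖B‖) * ‖φ‖ ^ 2 := by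
  obtain ⟨h1, h2, h3⟩ := summable_iSup_and_tsum_le
    (hasDerivAt_im_couplingElement hA hB (B φ))
    (fun t => im_couplingElement_nonneg hA hB (B φ) (by simp)) (norm_nonneg B)
    (abs_deriv_im_couplingElement_le hA hB (B φ))
    fun R hR => integral_im_couplingElement_le hA hB φ hR
  have hre : ∀ t : ℝ, (averagingElement A B φ t).re = (couplingElement A B (B φ) t).im :=
    fun t => by rw [averagingElement_eq hA hB, Complex.ofReal_re]
  simp only [hre]
  refine ⟨fun t => ?_, fun t => ⟨?_, ?_⟩, h1, h2, h3.trans ?_⟩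
  · exact IsBoundedInverse.boundedInverse ⟨_, isBoundedInverse_comp_conj hA hB t⟩
  · rw [averagingElement_eq hA hB, Complex.ofReal_im]
  · exact im_couplingElement_nonneg hA hB (B φ) (by simp)
  · have h4 : (inner ℂ φ (B φ)).re ≤ ‖B‖ * ‖φ‖ ^ 2 :=
      calc _ ≤ ‖φ‖ * ‖B φ‖ := (Complex.re_le_norm _).trans (norm_inner_le_norm _ _)
        _ ≤ ‖φ‖ * (‖B‖ * ‖φ‖) := by
          gcongr
          exact B.le_opNorm φ
        _ = _ := by ring
    have h5 : 0 ≤ (1 + ‖B‖) * Real.pi := by positivity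
    linarith [mul_le_mul_of_nonneg_left h4 h5]
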